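/- Let $\Gamma_1$ be an equilateral triangle (three vertices, three edges) with a horizontal bottom side and its apex on top. For $n\ge 1$ let $\Gamma_{n+1}$ be the graph obtained by partitioning an equilateral triangle (in the same position) into four equal smaller triangles and putting a copy of $\Gamma_n$ in each of the three corner triangles, where the copies share the midpoints of the sides of the large triangle as common vertices (the graphs $\Gamma_n$ are the Sierpiński graphs). Give every edge of $\Gamma_n$ its directional label: $a$ if the edge points up from left to right, $b$ if it is horizontal, and $c$ if it points down from left to right. The weight of a subgraph is the product of the labels of its edges, and the weighted generating function of a family of subgraphs is the sum of their weights; it is a polynomial in $a,b,c$, and the identities below are identities of polynomials, valid for all elements $a,b,c$ of an arbitrary commutative ring, in particular for positive reals. A spanning $k$-forest of a graph is an acyclic subgraph that contains all the vertices and has exactly $k$ connected components; a spanning tree is a spanning $1$-forest. Let - $T_n$ be the weighted generating function of the spanning trees of $\Gamma_n$; - $U_n$ (respectively $R_n$, $L_n$) be that of the spanning $2$-forests of $\Gamma_n$ in which the upmost (respectively rightmost, leftmost) vertex lies in one component and the two other outmost (corner) vertices lie together in the other component; - $Q_n$ be that of the spanning $3$-forests of $\Gamma_n$ in which the three outmost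 vertices lie in three different components. Then for every $n\ge 1$ $$T_{n+1}=2T_n^2(U_n+R_n+L_n),$$ $$U_{n+1}=T_nU_n(2R_n+2L_n+3U_n)+T_n^2Q_n,$$ $$R_{n+1}=T_nR_n(2L_n+2U_n+3R_n)+T_n^2Q_n,$$ $$L_{n+1}=T_nL_n(2R_n+2U_n+3L_n)+T_n^2Q_n,$$ $$Q_{n+1}=4T_nQ_n(U_n+R_n+L_n)+2\bigl(U_n^2(R_n+L_n)+R_n^2(L_n+U_n)+L_n^2(R_n+U_n)\bigr)+2U_nR_nL_n,$$ with the initial values $$T_1=ab+ac+bc,\qquad U_1=b,\qquad R_1=a,\qquad L_1=c,\qquad Q_1=1.$$ -/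

import Mathlib

/-! Weighted generating functions of spanning trees and spanning forests of a finite graph. -/

namespace SpanningGF

/-- `H` is a spanning tree of `G`; a spanning subgraph is a graph `H ≤ G` on all the vertices. -/
def IsSpanningTree {V : Type*} (G H : SimpleGraph V) : Prop :=
  H ≤ G ∧ H.IsTree

/-- `H` is a spanning `k`-forest of `G`: a spanning subgraph without cycles that has exactly
`k` connected components. -/
def IsSpanningForest {V : Type*} (G : SimpleGraph V) (k : ℕ) (H : SimpleGraph V) : Prop :=
  H ≤ G ∧ H.IsAcyclic ∧ Nat.card H.ConnectedComponent = k

open Classical in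
/-- The weight of a graph: the product of the weights of its edges. -/
noncomputable def weight {V K : Type*} [Fintype V] [CommRing K] (w : Sym2 V → K)
    (H : SimpleGraph V) : K :=
  ∏ e ∈ H.edgeFinset, w e

open Classical in
/-- The weighted generating function of the graphs `H` on the vertex set `V` with property `P`. -/
noncomputable def genFun {V K : Type*} [Fintype V] [CommRing K] (w : Sym2 V → K)
    (P : SimpleGraph V → Prop) : K :=
  ∑ H : SimpleGraph V with P H, weight w H

end SpanningGF

/-! The Sierpiński graphs. The pair `(i, j)` stands for the point `i • (1, 0) + j • (1/2, √3/2)`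
of the plane, in the triangular lattice with elementary triangles of side `1`. -/

namespace Sierpinski

/-- The vertices of the Sierpiński graph of side `2 ^ k`: the three vertices of an elementary
triangle for `k = 0`; then three copies, put in the corners of a triangle of doubled side. -/
def vertices : ℕ → Finset (ℕ × ℕ)
  | 0 => {(0, 0), (1, 0), (0, 1)}
  | k + 1 => vertices k
      ∪ (vertices k).image (fun p => p + (2 ^ k, 0))
      ∪ (vertices k).image (fun p => p + (0, 2 ^ k))

/-- The edges of the Sierpiński graph of side `2 ^ k`. -/
def edges : ℕ → Finset (Sym2 (ℕ × ℕ))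
  | 0 => {s((0, 0), (1, 0)), s((0, 0), (0, 1)), s((0, 1), (1, 0))}
  | k + 1 => edges k
      ∪ (edges k).image (Sym2.map (fun p => p + (2 ^ k, 0)))
      ∪ (edges k).image (Sym2.map (fun p => p + (0, 2 ^ k)))

theorem left_mem (k : ℕ) : ((0, 0) : ℕ × ℕ) ∈ vertices k := by
  induction k with
  | zero => simp [vertices]
  | succ k ih => simp [vertices, ih]

theorem right_mem (k : ℕ) : ((2 ^ k, 0) : ℕ × ℕ) ∈ vertices k := by
  induction k with
  | zero => simp [vertices]
  | succ k ih =>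
    simp only [vertices, Finset.mem_union, Finset.mem_image]
    exact Or.inl (Or.inr ⟨_, ih, by ext <;> simp [pow_succ, mul_two]⟩)

theorem up_mem (k : ℕ) : ((0, 2 ^ k) : ℕ × ℕ) ∈ vertices k := by
  induction k with
  | zero => simp [vertices]
  | succ k ih =>
    simp only [vertices, Finset.mem_union, Finset.mem_image]
    exact Or.inr ⟨_, ih, by ext <;> simp [pow_succ, mul_two]⟩

/-- The Sierpiński graph of side `2 ^ k`, as a graph on its finite vertex set. -/
def gasket (k : ℕ) : SimpleGraph (vertices k) :=
  (SimpleGraph.fromEdgeSet (edges k : Set (Sym2 (ℕ × ℕ)))).comap Subtype.val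

/-- Both end points of each of the listed edges are vertices. -/
theorem mem_vertices_of_mem_edges (k : ℕ) :
    ∀ e ∈ edges k, ∀ p ∈ e, p ∈ vertices k := by
  induction k with
  | zero => simp [edges, vertices]; grind
  | succ k ih =>
    intro e he p hp
    simp only [edges, Finset.mem_union, Finset.mem_image] at he
    simp only [vertices, Finset.mem_union, Finset.mem_image]
    rcases he with (he | ⟨f, hf, rfl⟩) | ⟨f, hf, rfl⟩
    · exact Or.inl (Or.inl (ih e he p hp))
    · obtain ⟨q, hq, rfl⟩ := Sym2.mem_map.1 hp
      exact Or.inl (Or.inr ⟨q, ih f hf q hq, rfl⟩)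
    · obtain ⟨q, hq, rfl⟩ := Sym2.mem_map.1 hp
      exact Or.inr ⟨q, ih f hf q hq, rfl⟩

/-- The leftmost vertex. -/
def left (k : ℕ) : vertices k := ⟨(0, 0), left_mem k⟩

/-- The rightmost vertex. -/
def right (k : ℕ) : vertices k := ⟨(2 ^ k, 0), right_mem k⟩

/-- The upmost vertex. -/
def up (k : ℕ) : vertices k := ⟨(0, 2 ^ k), up_mem k⟩

/-- The label of an edge of the triangular lattice, according to its direction: `b` for a
horizontal edge (equal second coordinates), `a` for an edge pointing up from left to right (equal
first coordinates), `c` for an edge pointing down from left to right. -/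
def label {K : Type*} (a b c : K) : Sym2 (ℕ × ℕ) → K :=
  Sym2.lift ⟨fun p q => if p.2 = q.2 then b else if p.1 = q.1 then a else c, by
    intro p q
    simp only [eq_comm]⟩

/-- The directional labelling of the Sierpiński graph of side `2 ^ k`. -/
def dirLabel {K : Type*} (a b c : K) (k : ℕ) (e : Sym2 (vertices k)) : K :=
  label a b c (e.map Subtype.val)

/-! The generating functions. For `n ≥ 1` the `n`-th graph `Γ_n` has side `2 ^ (n - 1)`, so that
`Γ_1` is a triangle; the value `n = 0` is not used. -/

open SpanningGF

/-- Spanning trees of `Γ_n`. -/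
noncomputable def T {K : Type*} [CommRing K] (a b c : K) (n : ℕ) : K :=
  genFun (dirLabel a b c (n - 1)) (fun H => IsSpanningTree (gasket (n - 1)) H)

/-- Spanning `2`-forests of `Γ_n` with the leftmost and the rightmost vertex in one component and
the upmost vertex in the other one. -/
noncomputable def U {K : Type*} [CommRing K] (a b c : K) (n : ℕ) : K :=
  genFun (dirLabel a b c (n - 1)) (fun H => IsSpanningForest (gasket (n - 1)) 2 H ∧
    H.Reachable (left (n - 1)) (right (n - 1)) ∧ ¬ H.Reachable (left (n - 1)) (up (n - 1)))

/-- Spanning `2`-forests of `Γ_n` with the leftmost and the upmost vertex in one component and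
the rightmost vertex in the other one. -/
noncomputable def R {K : Type*} [CommRing K] (a b c : K) (n : ℕ) : K :=
  genFun (dirLabel a b c (n - 1)) (fun H => IsSpanningForest (gasket (n - 1)) 2 H ∧
    H.Reachable (left (n - 1)) (up (n - 1)) ∧ ¬ H.Reachable (left (n - 1)) (right (n - 1)))

/-- Spanning `2`-forests of `Γ_n` with the rightmost and the upmost vertex in one component and
the leftmost vertex in the other one. -/
noncomputable def L {K : Type*} [CommRing K] (a b c : K) (n : ℕ) : K :=
  genFun (dirLabel a b c (n - 1)) (fun H => IsSpanningForest (gasket (n - 1)) 2 H ∧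
    H.Reachable (right (n - 1)) (up (n - 1)) ∧ ¬ H.Reachable (right (n - 1)) (left (n - 1)))

/-- Spanning `3`-forests of `Γ_n` with the leftmost, the rightmost and the upmost vertex in three
different components. -/
noncomputable def Q {K : Type*} [CommRing K] (a b c : K) (n : ℕ) : K :=
  genFun (dirLabel a b c (n - 1)) (fun H => IsSpanningForest (gasket (n - 1)) 3 H ∧
    ¬ H.Reachable (left (n - 1)) (right (n - 1)) ∧ ¬ H.Reachable (left (n - 1)) (up (n - 1)) ∧
    ¬ H.Reachable (right (n - 1)) (up (n - 1)))

end Sierpinski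

/-! The large graph is three copies of the smaller one, any two sharing exactly one midpoint. The
copies have no edge in common, so an edge set `S` of the large graph is a triple of edge sets `S i`,
and weights multiply. Which corners and midpoints (the "hubs") are connected by `S` depends only on
the partition, or pattern, that each `S i` induces on the three terminals of its copy.

Acyclicity is handled by counting: a graph is a forest iff edges plus components equal vertices. The
forests in question are exactly those in which every component contains a corner, so the number of
components is the number of blocks of the pattern, and being such a forest means: every vertex
reaches a terminal, the pattern is as prescribed, and the count holds. This condition passes from
the whole to the copies and back (`IsGluing.isRootedForest_iff`). Backwards, the counts add up.
Forwards, each copy satisfies an inequality, and a bound on the numbers of blocks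
(`size_le_of_glueLab`) forces equality in all three.

Each generating function is therefore a sum over the triples of patterns that combine to the
required one (`IsGluing.patternGF_eq`). There are only 125 triples; deciding each of them produces
the polynomials. Directional labels are translation invariant, so all copies have the same
generating functions, and the initial values come from the eight edge sets of a triangle. -/

namespace SimpleGraph

/-! ### Euler's formula and the counting criterion for forests. -/

variable {V : Type*}

/-- A set closed under adjacency contains everything that is reachable from its members. -/
theorem Reachable.mem_of_closed {G : SimpleGraph V} {p q : V} (h : G.Reachable p q) (Y : Set V)
    (hY : ∀ a b, G.Adj a b → a ∈ Y → b ∈ Y) (hp : p ∈ Y) : q ∈ Y := by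
  obtain ⟨w⟩ := h
  induction w with
  | nil => exact hp
  | cons hab _ ih => exact ih (hY _ _ hab hp)

/-- Joining two components by an edge lowers the number of components by one. -/
theorem card_connectedComponent_sup_edge [Finite V] {H : SimpleGraph V} {u v : V}
    (h : ¬ H.Reachable u v) :
    Nat.card (H ⊔ edge u v).ConnectedComponent + 1 = Nat.card H.ConnectedComponent := by
  classical
  have := Fintype.ofFinite H.ConnectedComponent
  have hle : H ≤ H ⊔ edge u v := le_sup_left
  have huv : u ≠ v := fun e => h (e ▸ Reachable.refl u)
  have hadj : (H ⊔ edge u v).Adj u v := by simp [edge_adj, huv]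
  let f : {C : H.ConnectedComponent // C ≠ H.connectedComponentMk v} →
      (H ⊔ edge u v).ConnectedComponent := fun C => C.1.map (Hom.ofLE hle)
  have hf : Function.Bijective f := by
    constructor
    · rintro ⟨C, hC⟩ ⟨D, hD⟩ hCD
      induction C using ConnectedComponent.ind with | _ a
      induction D using ConnectedComponent.ind with | _ b
      simp only [f, ConnectedComponent.map_mk, Hom.coe_ofLE, id_eq, ConnectedComponent.eq] at hCD
      rw [Ne, ConnectedComponent.eq] at hC hD
      -- `g` sends the class of `v` to that of `u`; it is constant along edges of the enlarged graph
      -- and injective on the classes other than that of `v`.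
      let g : V → H.ConnectedComponent := fun w =>
        if H.Reachable w v then H.connectedComponentMk u else H.connectedComponentMk w
      have hgu : g u = H.connectedComponentMk u := by simp [g]
      have hgv : g v = H.connectedComponentMk u := by simp [g]
      have hg : ∀ x y, (H ⊔ edge u v).Adj x y → g x = g y := by
        intro x y hxy
        rw [sup_adj, edge_adj] at hxy
        rcases hxy with hxy | ⟨⟨rfl, rfl⟩ | ⟨rfl, rfl⟩, -⟩
        · have hxv : H.Reachable x v ↔ H.Reachable y v :=
            ⟨fun k => hxy.symm.reachable.trans k, fun k => hxy.reachable.trans k⟩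
          simp only [g, hxv, ConnectedComponent.connectedComponentMk_eq_of_adj hxy]
        · rw [hgu, hgv]
        · rw [hgu, hgv]
      have hab : g a = g b := (hCD.mem_of_closed {x | g a = g x}
        (fun x y hxy hx => Eq.trans hx (hg x y hxy)) rfl)
      simpa [g, hC, hD] using hab
    · intro C
      induction C using ConnectedComponent.ind with | _ a
      by_cases ha : H.Reachable a v
      · refine ⟨⟨H.connectedComponentMk u, by rwa [Ne, ConnectedComponent.eq]⟩, ?_⟩
        simp only [f, ConnectedComponent.map_mk, Hom.coe_ofLE, id_eq, ConnectedComponent.eq]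
        exact hadj.reachable.trans (ha.mono hle).symm
      · exact ⟨⟨H.connectedComponentMk a, by rwa [Ne, ConnectedComponent.eq]⟩, rfl⟩
  rw [← Nat.card_congr (Equiv.ofBijective f hf), Nat.card_eq_fintype_card, Nat.card_eq_fintype_card,
    Fintype.card_subtype_compl, Fintype.card_subtype_eq]
  have : 0 < Fintype.card H.ConnectedComponent := Fintype.card_pos_iff.2 ⟨H.connectedComponentMk v⟩
  omega

/-- Euler's formula for forests. -/
theorem IsAcyclic.card_edgeSet_add_card_connectedComponent [Finite V] {H : SimpleGraph V}
    (hH : H.IsAcyclic) : Nat.card H.edgeSet + Nat.card H.ConnectedComponent = Nat.card V := by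
  classical
  have := Fintype.ofFinite V
  -- The induction joins two components by an edge until the forest is a tree, where the edge count
  -- is known.
  generalize hn : Nat.card H.ConnectedComponent = n
  induction n generalizing H with
  | zero =>
    have : IsEmpty V := by
      by_contra hV
      rw [not_isEmpty_iff] at hV
      have : Nonempty H.ConnectedComponent := hV.map H.connectedComponentMk
      exact Nat.card_pos.ne' hn
    have : IsEmpty H.edgeSet := ⟨fun e => Sym2.ind (fun x _ => this.elim x) e.1⟩
    simp
  | succ n ih =>
    by_cases hc : H.Preconnected
    · have hV : Nonempty V := by
        by_contra hV
        rw [not_nonempty_iff] at hV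
        have : IsEmpty H.ConnectedComponent := ⟨fun C => C.ind (fun x => hV.elim x)⟩
        simp at hn
      have : Subsingleton H.ConnectedComponent := hc.subsingleton_connectedComponent
      have h1 : Nat.card H.ConnectedComponent ≤ 1 := Finite.card_le_one_iff_subsingleton.2 this
      have := (isTree_iff_connected_and_card.1 ⟨⟨hc⟩, hH⟩).2
      omega
    · simp only [Preconnected, not_forall] at hc
      obtain ⟨u, v, huv⟩ := hc
      have h1 := card_connectedComponent_sup_edge huv
      have h2 := ih (hH.sup_edge_of_not_reachable huv) (by omega)
      have h3 := H.card_edgeFinset_sup_edge (fun k => huv k.reachable)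
        (fun e => huv (e ▸ Reachable.refl u))
      simp only [edgeFinset_card, ← Nat.card_eq_fintype_card] at h3
      omega

/-- A spanning forest `F ≤ H` with the same reachability relation has the same components and
satisfies Euler's formula; equality for `H` leaves no room for further edges, so `F = H`. -/
theorem card_le_card_edgeSet_add_card_connectedComponent [Finite V] (H : SimpleGraph V) :
    Nat.card V ≤ Nat.card H.edgeSet + Nat.card H.ConnectedComponent ∧
      (Nat.card H.edgeSet + Nat.card H.ConnectedComponent = Nat.card V → H.IsAcyclic) := by
  classical
  have := Fintype.ofFinite V
  obtain ⟨F, hF, hac, hr⟩ := H.exists_isAcyclic_reachable_eq_le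
  have h1 := hac.card_edgeSet_add_card_connectedComponent
  have h2 : Nat.card F.ConnectedComponent = Nat.card H.ConnectedComponent := by
    refine Nat.card_congr (Quot.congrRight fun a b => ?_)
    rw [hr]
  simp only [Nat.card_eq_fintype_card (α := edgeSet _), ← edgeFinset_card] at h1 ⊢
  refine ⟨?_, fun h => ?_⟩
  · have := Finset.card_le_card (edgeFinset_mono hF)
    omega
  · have : F = H := by
      rw [← edgeFinset_inj]
      exact Finset.eq_of_subset_of_card_le (edgeFinset_mono hF) (by omega)
    exact this ▸ hac

theorem isAcyclic_iff_card_edgeSet_add_card_connectedComponent [Finite V] (H : SimpleGraph V) :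
    H.IsAcyclic ↔ Nat.card H.edgeSet + Nat.card H.ConnectedComponent = Nat.card V :=
  ⟨fun h => h.card_edgeSet_add_card_connectedComponent,
    H.card_le_card_edgeSet_add_card_connectedComponent.2⟩

end SimpleGraph

/-! ### Edge sets, patterns and rooted forests. -/

namespace SpanningGF

/-- The vertices `p` and `q` are joined by a path with edges in `S`. -/
def Conn {α : Type*} (S : Finset (Sym2 α)) (p q : α) : Prop :=
  (SimpleGraph.fromEdgeSet (S : Set (Sym2 α))).Reachable p q

namespace Conn

variable {α : Type*} {S S' : Finset (Sym2 α)} {p q r : α}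

theorem refl (S : Finset (Sym2 α)) (p : α) : Conn S p p := SimpleGraph.Reachable.refl p

theorem symm (h : Conn S p q) : Conn S q p := SimpleGraph.Reachable.symm h

theorem trans (h : Conn S p q) (h' : Conn S q r) : Conn S p r := SimpleGraph.Reachable.trans h h'

theorem mono (hS : S ⊆ S') (h : Conn S p q) : Conn S' p q :=
  SimpleGraph.Reachable.mono (SimpleGraph.fromEdgeSet_mono (by exact_mod_cast hS)) h

theorem of_mem (h : s(p, q) ∈ S) : Conn S p q := by
  by_cases hpq : p = q
  · exact hpq ▸ refl S p
  · exact SimpleGraph.Adj.reachable (by simp [h, hpq])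

theorem mem_of_closed (h : Conn S p q) (Y : Set α)
    (hY : ∀ a b, s(a, b) ∈ S → a ∈ Y → b ∈ Y) (hp : p ∈ Y) : q ∈ Y :=
  SimpleGraph.Reachable.mem_of_closed h Y (fun a b hab => hY a b (by simpa using hab.1)) hp

end Conn

/-- The five partitions of the three terminals `0` (left), `1` (right) and `2` (up). -/
inductive Pattern
  | joined | upAlone | rightAlone | leftAlone | discrete
  deriving DecidableEq

namespace Pattern

instance : Fintype Pattern where
  elems := {joined, upAlone, rightAlone, leftAlone, discrete}
  complete π := by cases π <;> decide

/-- A labelling of the terminals whose fibres are the blocks of the partition. -/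
def lab : Pattern → Fin 3 → Fin 3
  | joined => ![0, 0, 0]
  | upAlone => ![0, 0, 2]
  | rightAlone => ![0, 1, 0]
  | leftAlone => ![0, 1, 1]
  | discrete => ![0, 1, 2]

/-- The number of blocks. -/
def size : Pattern → ℕ
  | joined => 1
  | upAlone | rightAlone | leftAlone => 2
  | discrete => 3

theorem card_image_lab (π : Pattern) : (Finset.univ.image π.lab).card = π.size := by
  cases π <;> rfl

/-- Every equivalence relation on the terminals is one of the five patterns. -/
theorem exists_lab {r : Fin 3 → Fin 3 → Prop} (hr : Equivalence r) :
    ∃ π : Pattern, ∀ i j, r i j ↔ π.lab i = π.lab j := by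
  have h0 := hr.refl
  have h1 : ∀ i j, r i j ↔ r j i := fun i j => ⟨hr.symm, hr.symm⟩
  have h2 : r 0 1 → (r 0 2 ↔ r 1 2) := fun h => ⟨hr.trans (hr.symm h), hr.trans h⟩
  have h3 : r 0 2 → r 1 2 → r 0 1 := fun h k => hr.trans h (hr.symm k)
  -- Of the eight cases, the three with exactly two relations true contradict transitivity; the
  -- other five are the patterns.
  by_cases h01 : r 0 1 <;> by_cases h02 : r 0 2 <;> by_cases h12 : r 1 2
  all_goals try exact absurd (h3 ‹_› ‹_›) ‹_›
  all_goals try exact absurd ((h2 ‹_›).1 ‹_›) ‹_›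
  all_goals try exact absurd ((h2 ‹_›).2 ‹_›) ‹_›
  on_goal 1 => refine ⟨joined, ?_⟩
  on_goal 2 => refine ⟨upAlone, ?_⟩
  on_goal 3 => refine ⟨rightAlone, ?_⟩
  on_goal 4 => refine ⟨leftAlone, ?_⟩
  on_goal 5 => refine ⟨discrete, ?_⟩
  all_goals
    simp only [Fin.forall_fin_succ, Fin.succ_zero_eq_one, Fin.succ_one_eq_two, IsEmpty.forall_iff,
      h0, h1 1 0, h1 2 0, h1 2 1, h01, h02, h12, true_iff, false_iff]
    decide

end Pattern

/-- The edge set `S` is a forest on `V` whose components all contain terminals and cut out the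
partition `π` of the terminals. -/
structure IsRootedForest {α : Type*} (V : Finset α) (t : Fin 3 → α) (π : Pattern)
    (S : Finset (Sym2 α)) : Prop where
  conn : ∀ v ∈ V, ∃ i, Conn S v (t i)
  pattern : ∀ i j, Conn S (t i) (t j) ↔ π.lab i = π.lab j
  card : S.card + π.size = V.card

/-- The terminals `t` and the edge set `E` lie on the vertex set `V`, and `E` has no loops. -/
structure IsNetwork {α : Type*} (V : Finset α) (t : Fin 3 → α) (E : Finset (Sym2 α)) : Prop where
  terminal : ∀ i, t i ∈ V
  ends : ∀ e ∈ E, ∀ p ∈ e, p ∈ V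
  loopless : ∀ e ∈ E, ¬ e.IsDiag

/-- The graph on `V` with edge set `S`. -/
def graphOn {α : Type*} (V : Finset α) (S : Finset (Sym2 α)) : SimpleGraph V :=
  (SimpleGraph.fromEdgeSet (S : Set (Sym2 α))).comap Subtype.val

/-! ### Comparison of edge sets with graphs on the vertex set. -/

section Transfer

variable {α : Type*} {V : Finset α} {t : Fin 3 → α} {E S : Finset (Sym2 α)}

theorem IsNetwork.subset (h : IsNetwork V t E) (hS : S ⊆ E) : IsNetwork V t S :=
  ⟨h.terminal, fun e he => h.ends e (hS he), fun e he => h.loopless e (hS he)⟩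

theorem IsNetwork.graphOn_adj (h : IsNetwork V t S) {p q : V} :
    (graphOn V S).Adj p q ↔ s((p : α), (q : α)) ∈ S := by
  simp only [graphOn, SimpleGraph.comap_adj, SimpleGraph.fromEdgeSet_adj, Finset.mem_coe,
    and_iff_left_iff_imp]
  exact fun hpq => h.loopless _ hpq

/-- A vertex set is not left by a path. -/
theorem IsNetwork.mem_of_conn (h : IsNetwork V t S) {p q : α} (hpq : Conn S p q) (hp : p ∈ V) :
    q ∈ V :=
  hpq.mem_of_closed (V : Set α) (fun _ _ hab _ => h.ends _ hab _ (Sym2.mem_mk_right _ _)) hp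

theorem IsNetwork.reachable_iff (h : IsNetwork V t S) (p q : V) :
    (graphOn V S).Reachable p q ↔ Conn S p q := by
  refine ⟨fun k => ?_, fun k => ?_⟩
  · exact k.mem_of_closed {x | Conn S p x}
      (fun a b hab ha => Conn.trans ha (Conn.of_mem (h.graphOn_adj.1 hab))) (Conn.refl _ _)
  · have : (q : α) ∈ {x | ∃ hx : x ∈ V, (graphOn V S).Reachable p ⟨x, hx⟩} := by
      refine k.mem_of_closed _ ?_ ⟨p.2, SimpleGraph.Reachable.refl _⟩
      rintro a b hab ⟨ha, hpa⟩
      have hb := h.ends _ hab _ (Sym2.mem_mk_right _ _)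
      exact ⟨hb, hpa.trans (SimpleGraph.Adj.reachable (v := ⟨b, hb⟩) (h.graphOn_adj.2 hab))⟩
    exact this.2

theorem IsNetwork.image_edgeSet (h : IsNetwork V t S) :
    Sym2.map Subtype.val '' (graphOn V S).edgeSet = (S : Set (Sym2 α)) := by
  ext e
  induction e using Sym2.ind with | _ p q
  constructor
  · rintro ⟨f, hf, hfe⟩
    induction f using Sym2.ind with | _ x y
    rw [← hfe]
    exact h.graphOn_adj.1 hf
  · intro he
    exact ⟨s(⟨p, h.ends _ he _ (Sym2.mem_mk_left _ _)⟩, ⟨q, h.ends _ he _ (Sym2.mem_mk_right _ _)⟩),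
      h.graphOn_adj.2 he, rfl⟩

theorem IsNetwork.card_edgeSet (h : IsNetwork V t S) :
    Nat.card (graphOn V S).edgeSet = S.card := by
  rw [← Set.ncard_coe_finset, ← h.image_edgeSet,
    Set.ncard_image_of_injective _ (Sym2.map.injective Subtype.val_injective)]
  rfl

/-- Every component contains a terminal if and only if there are as many components as blocks of
the partition of the terminals. -/
theorem IsNetwork.conn_iff_card (h : IsNetwork V t S) {π : Pattern}
    (hπ : ∀ i j, Conn S (t i) (t j) ↔ π.lab i = π.lab j) :
    (∀ v ∈ V, ∃ i, Conn S v (t i)) ↔ Nat.card (graphOn V S).ConnectedComponent = π.size := by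
  classical
  have := Fintype.ofFinite (graphOn V S).ConnectedComponent
  let f : Fin 3 → (graphOn V S).ConnectedComponent := fun i =>
    (graphOn V S).connectedComponentMk ⟨t i, h.terminal i⟩
  have hf : ∀ i j, f i = f j ↔ π.lab i = π.lab j := fun i j => by
    rw [← hπ, SimpleGraph.ConnectedComponent.eq, h.reachable_iff]
  -- `f` and `π.lab` have the same fibres, so their images are equinumerous. It then remains to see
  -- that `f` is surjective iff every vertex reaches a terminal.
  have hcard : (Finset.univ.image f).card = π.size := by
    rw [← π.card_image_lab]
    refine Finset.card_bij' (fun C _ => if hC : ∃ i, f i = C then π.lab hC.choose else 0)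
      (fun k _ => if hk : ∃ i, π.lab i = k then f hk.choose else f 0) ?_ ?_ ?_ ?_
    · intro C hC
      simp only [Finset.mem_image, Finset.mem_univ, true_and] at hC ⊢
      exact ⟨hC.choose, by rw [dif_pos hC]⟩
    · intro k hk
      simp only [Finset.mem_image, Finset.mem_univ, true_and] at hk ⊢
      exact ⟨hk.choose, by rw [dif_pos hk]⟩
    · intro C hC
      simp only [Finset.mem_image, Finset.mem_univ, true_and] at hC
      simp only [dif_pos hC]
      have hk : ∃ i, π.lab i = π.lab hC.choose := ⟨_, rfl⟩
      rw [dif_pos hk, (hf _ _).2 hk.choose_spec, hC.choose_spec]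
    · intro k hk
      simp only [Finset.mem_image, Finset.mem_univ, true_and] at hk
      simp only [dif_pos hk]
      have hC : ∃ i, f i = f hk.choose := ⟨_, rfl⟩
      rw [dif_pos hC, (hf _ _).1 hC.choose_spec, hk.choose_spec]
  rw [← hcard, Nat.card_eq_fintype_card, eq_comm, Finset.card_eq_iff_eq_univ,
    Finset.eq_univ_iff_forall]
  constructor
  · intro k C
    induction C using SimpleGraph.ConnectedComponent.ind with | _ v
    obtain ⟨i, hi⟩ := k v v.2
    refine Finset.mem_image.2 ⟨i, Finset.mem_univ _, ?_⟩
    rw [SimpleGraph.ConnectedComponent.eq, h.reachable_iff]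
    exact hi.symm
  · intro k v hv
    obtain ⟨i, -, hi⟩ := Finset.mem_image.1 (k ((graphOn V S).connectedComponentMk ⟨v, hv⟩))
    rw [SimpleGraph.ConnectedComponent.eq, h.reachable_iff] at hi
    exact ⟨i, hi.symm⟩

/-- Once the components are counted by the blocks of `π`, the field `card` is Euler's formula, that
is, acyclicity. -/
theorem IsNetwork.isRootedForest_iff (h : IsNetwork V t S) (π : Pattern) :
    IsRootedForest V t π S ↔ (graphOn V S).IsAcyclic ∧
      Nat.card (graphOn V S).ConnectedComponent = π.size ∧
      ∀ i j, Conn S (t i) (t j) ↔ π.lab i = π.lab j := by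
  rw [SimpleGraph.isAcyclic_iff_card_edgeSet_add_card_connectedComponent, h.card_edgeSet,
    Nat.card_eq_fintype_card (α := V), Fintype.card_coe]
  constructor
  · rintro ⟨h1, h2, h3⟩
    have h4 := (h.conn_iff_card h2).1 h1
    exact ⟨by rw [h4, h3], h4, h2⟩
  · rintro ⟨h1, h2, h3⟩
    exact ⟨(h.conn_iff_card h3).2 h2, h3, by rw [← h1, h2]⟩

theorem IsNetwork.card_le (h : IsNetwork V t S) {π : Pattern}
    (hconn : ∀ v ∈ V, ∃ i, Conn S v (t i))
    (hπ : ∀ i j, Conn S (t i) (t j) ↔ π.lab i = π.lab j) : V.card ≤ S.card + π.size := by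
  have h1 := (graphOn V S).card_le_card_edgeSet_add_card_connectedComponent.1
  rwa [h.card_edgeSet, (h.conn_iff_card hπ).1 hconn, Nat.card_eq_fintype_card,
    Fintype.card_coe] at h1

end Transfer

open Classical in
/-- The weighted generating function of the rooted forests with a given partition. -/
noncomputable def patternGF {α K : Type*} [CommRing K] (V : Finset α) (t : Fin 3 → α)
    (E : Finset (Sym2 α)) (w : Sym2 α → K) (π : Pattern) : K :=
  ∑ S ∈ E.powerset with IsRootedForest V t π S, ∏ e ∈ S, w e

/-- The generating function of the subgraphs of a graph on `V` that are forests with a given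
pattern, as a sum over sets of edges. -/
theorem genFun_eq_patternGF {α K : Type*} [CommRing K] {V : Finset α} {t : Fin 3 → α}
    {E : Finset (Sym2 α)} (hE : IsNetwork V t E) (w : Sym2 α → K) (π : Pattern)
    (P : SimpleGraph V → Prop)
    (hP : ∀ S ⊆ E, P (graphOn V S) ↔ IsRootedForest V t π S)
    (hle : ∀ H, P H → H ≤ graphOn V E) :
    genFun (fun e : Sym2 V => w (e.map Subtype.val)) P = patternGF V t E w π := by
  classical
  rw [genFun, patternGF]
  have key : ∀ H : SimpleGraph V, H ≤ graphOn V E →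
      H.edgeFinset.image (Sym2.map Subtype.val) ⊆ E ∧
      graphOn V (H.edgeFinset.image (Sym2.map Subtype.val)) = H := by
    intro H hH
    have h1 : H.edgeFinset.image (Sym2.map Subtype.val) ⊆ E := by
      intro e he
      obtain ⟨f, hf, rfl⟩ := Finset.mem_image.1 he
      induction f using Sym2.ind with | _ p q
      exact hE.graphOn_adj.1 (hH (by simpa using hf))
    refine ⟨h1, ?_⟩
    ext p q
    rw [(hE.subset h1).graphOn_adj, Finset.mem_image]
    constructor
    · rintro ⟨f, hf, hfe⟩
      have : f = s(p, q) := Sym2.map.injective Subtype.val_injective hfe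
      simpa [this] using hf
    · exact fun hpq => ⟨s(p, q), by simpa using hpq, rfl⟩
  refine Finset.sum_bij' (fun H _ => H.edgeFinset.image (Sym2.map Subtype.val))
    (fun S _ => graphOn V S) ?_ ?_ ?_ ?_ ?_
  · intro H hH
    simp only [Finset.mem_filter, Finset.mem_univ, true_and, Finset.mem_powerset] at hH ⊢
    obtain ⟨h1, h2⟩ := key H (hle H hH)
    exact ⟨h1, (hP _ h1).1 (h2.symm ▸ hH)⟩
  · intro S hS
    simp only [Finset.mem_filter, Finset.mem_univ, true_and, Finset.mem_powerset] at hS ⊢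
    exact (hP S hS.1).2 hS.2
  · intro H hH
    simp only [Finset.mem_filter, Finset.mem_univ, true_and] at hH
    exact (key H (hle H hH)).2
  · intro S hS
    simp only [Finset.mem_filter, Finset.mem_powerset] at hS
    have := (hE.subset hS.1).image_edgeSet
    rw [← Finset.coe_inj, Finset.coe_image, SimpleGraph.coe_edgeFinset]
    exact this
  · intro H _
    rw [weight, Finset.prod_image (fun x _ y _ hxy => Sym2.map.injective Subtype.val_injective hxy)]

end SpanningGF

/-! ### Gluing three patterns: a finite computation on six hubs. -/

namespace SpanningGF

namespace Pattern

/-- Pairs of terminals whose identification generates the partition. -/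
def pairs : Pattern → List (Fin 3 × Fin 3)
  | joined => [(0, 1), (0, 2)]
  | upAlone => [(0, 1)]
  | rightAlone => [(0, 2)]
  | leftAlone => [(1, 2)]
  | discrete => []

/-- Generation is expressed by a universal property: a map factors through the partition iff it
equates the generating pairs. The gluing of patterns is characterised in the same way. -/
theorem forall_pairs (π : Pattern) {β : Type*} (X : Fin 3 → β) :
    (∀ e ∈ π.pairs, X e.1 = X e.2) ↔ ∀ i j, π.lab i = π.lab j → X i = X j := by
  cases π <;>
    simp +decide [pairs, lab, Fin.forall_fin_succ] <;> grind

theorem eq_of_lab {π ρ : Pattern}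
    (h : ∀ i j, π.lab i = π.lab j ↔ ρ.lab i = ρ.lab j) : π = ρ := by
  revert h; revert π ρ; decide

end Pattern

/-- The terminals of the three copies, numbered `0`, `1`, `2` for the outer left, right and upmost
corners and `3`, `4`, `5` for the midpoints of the bottom, left and right sides. The copies are
numbered by the outer corner they contain. -/
def hub : Fin 3 → Fin 3 → Fin 6 := ![![0, 3, 4], ![3, 1, 5], ![4, 5, 2]]

/-- The outer corners. -/
def outer : Fin 3 → Fin 6 := ![0, 1, 2]

/-- Identify the labels of two points. -/
def mergeLab (f : Fin 6 → Fin 6) (e : Fin 6 × Fin 6) : Fin 6 → Fin 6 :=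
  fun p => if f p = f e.2 then f e.1 else f p

theorem forall_mergeLab (f : Fin 6 → Fin 6) (e : Fin 6 × Fin 6) {β : Type*} (X : Fin 6 → β) :
    (∀ p q, mergeLab f e p = mergeLab f e q → X p = X q) ↔
      (∀ p q, f p = f q → X p = X q) ∧ X e.1 = X e.2 := by
  unfold mergeLab
  constructor
  · refine fun h => ⟨fun p q hpq => h p q (by rw [hpq]), h _ _ ?_⟩
    simp
  · rintro ⟨h, h'⟩ p q hpq
    split_ifs at hpq with h1 h2 h2
    · exact (h _ _ h1).trans (h _ _ h2).symm
    · exact ((h _ _ h1).trans h'.symm).trans (h _ _ hpq)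
    · exact ((h _ _ hpq).trans h').trans (h _ _ h2).symm
    · exact h _ _ hpq

theorem forall_foldl_mergeLab (l : List (Fin 6 × Fin 6)) (f : Fin 6 → Fin 6) {β : Type*}
    (X : Fin 6 → β) :
    (∀ p q, l.foldl mergeLab f p = l.foldl mergeLab f q → X p = X q) ↔
      (∀ p q, f p = f q → X p = X q) ∧ ∀ e ∈ l, X e.1 = X e.2 := by
  induction l generalizing f with
  | nil => simp
  | cons e l ih => rw [List.foldl_cons, ih, forall_mergeLab, List.forall_mem_cons, and_assoc]

/-- The pairs of hubs identified by the patterns of the three copies. -/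
def hubPairs (π : Fin 3 → Pattern) : List (Fin 6 × Fin 6) :=
  ((π 0).pairs.map fun e => (hub 0 e.1, hub 0 e.2)) ++
    ((π 1).pairs.map fun e => (hub 1 e.1, hub 1 e.2)) ++
    ((π 2).pairs.map fun e => (hub 2 e.1, hub 2 e.2))

/-- The labelling of the hubs generated by the patterns of the three copies. -/
def glueLab (π : Fin 3 → Pattern) : Fin 6 → Fin 6 := (hubPairs π).foldl mergeLab id

/-- This universal property is all that is needed to show that `glueLab` describes connectivity: it
is applied to `glueLab` itself and to a proposition-valued `X`. -/
theorem forall_glueLab (π : Fin 3 → Pattern) {β : Type*} (X : Fin 6 → β) :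
    (∀ p q, glueLab π p = glueLab π q → X p = X q) ↔
      ∀ i j k, (π i).lab j = (π i).lab k → X (hub i j) = X (hub i k) := by
  have h (i : Fin 3) := (π i).forall_pairs (fun j => X (hub i j))
  rw [glueLab, forall_foldl_mergeLab]
  simp only [hubPairs, List.mem_append, List.mem_map, id_eq, forall_eq', implies_true, true_and,
    ← h]
  simp [Fin.forall_fin_succ, or_imp, forall_and]
  grind

/-- The patterns of the three copies produce the pattern `τ` without cycles. -/
def Combines (π : Fin 3 → Pattern) (τ : Pattern) : Prop :=
  (∀ p, ∃ o, glueLab π p = glueLab π (outer o)) ∧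
    (∀ i j, glueLab π (outer i) = glueLab π (outer j) ↔ τ.lab i = τ.lab j) ∧
    (π 0).size + (π 1).size + (π 2).size = 3 + τ.size

instance (π : Fin 3 → Pattern) (τ : Pattern) : Decidable (Combines π τ) := by
  unfold Combines; infer_instance

/-- Gluing makes three identifications of terminals, each of which lowers the number of blocks by at
most one, and `τ.size` blocks remain since every hub is joined to an outer corner. Equality, as
required in `Combines`, means that no identification closes a cycle. The proof checks all cases. -/
theorem size_le_of_glueLab (π : Fin 3 → Pattern) (τ : Pattern)
    (h1 : ∀ p, ∃ o, glueLab π p = glueLab π (outer o))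
    (h2 : ∀ i j, glueLab π (outer i) = glueLab π (outer j) ↔ τ.lab i = τ.lab j) :
    (π 0).size + (π 1).size + (π 2).size ≤ 3 + τ.size := by
  have key : ∀ A B C τ : Pattern,
      (∀ p, ∃ o, glueLab ![A, B, C] p = glueLab ![A, B, C] (outer o)) →
      (∀ i j, glueLab ![A, B, C] (outer i) = glueLab ![A, B, C] (outer j) ↔ τ.lab i = τ.lab j) →
      A.size + B.size + C.size ≤ 3 + τ.size := by
    decide +kernel
  have hπ : π = ![π 0, π 1, π 2] := by
    ext i; fin_cases i <;> rfl
  rw [hπ] at h1 h2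
  exact key _ _ _ _ h1 h2

end SpanningGF

/-! ### Gluing three networks. -/

namespace SpanningGF

/-- Three networks, glued along the midpoints of the sides of a triangle. -/
structure IsGluing {α : Type*} (h : Fin 6 → α) (V : Fin 3 → Finset α)
    (E : Fin 3 → Finset (Sym2 α)) : Prop where
  inj : Function.Injective h
  net : ∀ i, IsNetwork (V i) (fun j => h (hub i j)) (E i)
  inter : ∀ i j, i ≠ j → ∀ v ∈ V i, v ∈ V j → ∃ p, v = h (hub i p)

section Gluing

variable {α : Type*} {h : Fin 6 → α} {V : Fin 3 → Finset α}
  {E S : Fin 3 → Finset (Sym2 α)}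

theorem IsGluing.subset (hG : IsGluing h V E) (hS : ∀ i, S i ⊆ E i) : IsGluing h V S :=
  ⟨hG.inj, fun i => (hG.net i).subset (hS i), hG.inter⟩

theorem IsRootedForest.eq_pattern {V : Finset α} {t : Fin 3 → α} {S : Finset (Sym2 α)}
    {π ρ : Pattern} (h : IsRootedForest V t π S) (h' : IsRootedForest V t ρ S) : π = ρ :=
  Pattern.eq_of_lab fun i j => (h.pattern i j).symm.trans (h'.pattern i j)

theorem IsGluing.exists_hub (hG : IsGluing h V E) {i : Fin 3} {p : Fin 6} (hp : h p ∈ V i) :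
    ∃ j, p = hub i j := by
  have : ∃ i' j', p = hub i' j' := by clear hp; revert p; decide
  obtain ⟨i', j', rfl⟩ := this
  by_cases hi : i = i'
  · exact ⟨j', by rw [hi]⟩
  · obtain ⟨q, hq⟩ := hG.inter i i' hi _ hp ((hG.net i').terminal j')
    exact ⟨q, hG.inj hq⟩

variable [DecidableEq α]

theorem IsGluing.card_inter (hG : IsGluing h V E) {i j : Fin 3} (hij : i ≠ j) {p : Fin 6}
    (hp : ∀ a, (∃ b c, a = hub i b ∧ a = hub j c) ↔ a = p) : V i ∩ V j = {h p} := by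
  ext v
  rw [Finset.mem_inter, Finset.mem_singleton]
  constructor
  · rintro ⟨h1, h2⟩
    obtain ⟨b, rfl⟩ := hG.inter i j hij v h1 h2
    obtain ⟨c, hc⟩ := hG.exists_hub h2
    rw [(hp _).1 ⟨b, c, rfl, hc⟩]
  · rintro rfl
    obtain ⟨b, c, h1, h2⟩ := (hp p).2 rfl
    exact ⟨h1 ▸ (hG.net i).terminal b, h2 ▸ (hG.net j).terminal c⟩

/-- Any two copies meet in one midpoint, and the midpoints are distinct, so inclusion-exclusion
loses `1 + 2` vertices. -/
theorem IsGluing.card_biUnion (hG : IsGluing h V E) :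
    (Finset.univ.biUnion V).card + 3 = (V 0).card + (V 1).card + (V 2).card := by
  have h01 : V 0 ∩ V 1 = {h 3} := hG.card_inter (by decide) (by decide)
  have h02 : V 0 ∩ V 2 = {h 4} := hG.card_inter (by decide) (by decide)
  have h12 : V 1 ∩ V 2 = {h 5} := hG.card_inter (by decide) (by decide)
  have hU : Finset.univ.biUnion V = V 0 ∪ V 1 ∪ V 2 := by
    ext v
    simp [Fin.exists_fin_succ]
  have h3 : (V 0 ∪ V 1) ∩ V 2 = {h 4, h 5} := by
    rw [Finset.union_inter_distrib_right, h02, h12]; rfl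
  have h1 := Finset.card_union_add_card_inter (V 0) (V 1)
  have h2 := Finset.card_union_add_card_inter (V 0 ∪ V 1) (V 2)
  rw [h01, Finset.card_singleton] at h1
  rw [h3, Finset.card_pair (fun e => absurd (hG.inj e) (by decide))] at h2
  rw [hU]
  omega

/-- Two copies share a single vertex, so a common edge would be a loop. -/
theorem IsGluing.disjoint (hG : IsGluing h V E) {i j : Fin 3} (hij : i ≠ j) :
    Disjoint (E i) (E j) := by
  rw [Finset.disjoint_left]
  intro e hi hj
  have hV : ∃ x, V i ∩ V j = {x} := by
    have : ∀ i j : Fin 3, i ≠ j → ∃ p : Fin 6, ∀ a, (∃ b c, a = hub i b ∧ a = hub j c) ↔ a = p := by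
      decide
    obtain ⟨p, hp⟩ := this i j hij
    exact ⟨_, hG.card_inter hij hp⟩
  obtain ⟨x, hx⟩ := hV
  induction e using Sym2.ind with | _ a b
  have ha : a ∈ V i ∩ V j := Finset.mem_inter.2
    ⟨(hG.net i).ends _ hi _ (Sym2.mem_mk_left _ _), (hG.net j).ends _ hj _ (Sym2.mem_mk_left _ _)⟩
  have hb : b ∈ V i ∩ V j := Finset.mem_inter.2
    ⟨(hG.net i).ends _ hi _ (Sym2.mem_mk_right _ _), (hG.net j).ends _ hj _ (Sym2.mem_mk_right _ _)⟩
  rw [hx, Finset.mem_singleton] at ha hb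
  exact (hG.net i).loopless _ hi (by rw [ha, hb]; exact Sym2.diag_isDiag x)

theorem IsGluing.isNetwork (hG : IsGluing h V E) :
    IsNetwork (Finset.univ.biUnion V) (fun o => h (outer o)) (Finset.univ.biUnion E) := by
  refine ⟨fun o => ?_, fun e he p hp => ?_, fun e he => ?_⟩
  · have : outer o = hub o o := by revert o; decide
    rw [this]
    exact Finset.mem_biUnion.2 ⟨o, Finset.mem_univ _, (hG.net o).terminal o⟩
  · obtain ⟨i, -, hi⟩ := Finset.mem_biUnion.1 he
    exact Finset.mem_biUnion.2 ⟨i, Finset.mem_univ _, (hG.net i).ends e hi p hp⟩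
  · obtain ⟨i, -, hi⟩ := Finset.mem_biUnion.1 he
    exact (hG.net i).loopless e hi

theorem Conn.biUnion {i : Fin 3} {p q : α} (hpq : Conn (S i) p q) :
    Conn (Finset.univ.biUnion S) p q :=
  hpq.mono (Finset.subset_biUnion_of_mem S (Finset.mem_univ i))

/-- The connections between hubs are generated by the connections within the copies. -/
theorem IsGluing.conn_hub_iff (hG : IsGluing h V S) {π : Fin 3 → Pattern}
    (hπ : ∀ i j k, Conn (S i) (h (hub i j)) (h (hub i k)) ↔ (π i).lab j = (π i).lab k)
    (p q : Fin 6) :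
    Conn (Finset.univ.biUnion S) (h p) (h q) ↔ glueLab π p = glueLab π q := by
  have hclosed := (forall_glueLab π (glueLab π)).1 (fun _ _ h => h)
  constructor
  · intro hpq
    -- This set is closed under all edges: a path changes copy only at a hub, where the terminal `j`
    -- can be replaced by that hub without changing the glued label.
    have : h q ∈ {v | ∃ i j, v ∈ V i ∧ Conn (S i) v (h (hub i j)) ∧
        glueLab π p = glueLab π (hub i j)} := by
      refine hpq.mem_of_closed _ ?_ ?_
      · rintro a b hab ⟨i, j, hai, haj, hj⟩
        obtain ⟨i', -, hab⟩ := Finset.mem_biUnion.1 hab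
        have hai' := (hG.net i').ends _ hab a (Sym2.mem_mk_left _ _)
        have hbi' := (hG.net i').ends _ hab b (Sym2.mem_mk_right _ _)
        have hba : Conn (S i') b a := (Conn.of_mem hab).symm
        by_cases hi : i' = i
        · subst hi
          exact ⟨i', j, hbi', hba.trans haj, hj⟩
        · obtain ⟨k', rfl⟩ := hG.inter i' i hi a hai' hai
          obtain ⟨k, hk⟩ := hG.exists_hub hai
          rw [hk] at haj
          refine ⟨i', k', hbi', hba, ?_⟩
          rw [hj, hk]
          exact (hclosed i k j ((hπ i k j).1 haj)).symm
      · have : ∃ i j, p = hub i j := by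
          clear hpq; revert p; decide
        obtain ⟨i, j, rfl⟩ := this
        exact ⟨i, j, (hG.net i).terminal j, Conn.refl _ _, rfl⟩
    obtain ⟨i, j, hqi, hqj, hj⟩ := this
    obtain ⟨k, rfl⟩ := hG.exists_hub hqi
    rw [hj]
    exact (hclosed i k j ((hπ i k j).1 hqj)).symm
  · intro hpq
    have := (forall_glueLab π (fun x => Conn (Finset.univ.biUnion S) (h p) (h x))).2
      (fun i j k hjk => propext ?_) p q hpq
    · exact this.mp (Conn.refl _ _)
    · have hc := Conn.biUnion ((hπ i j k).2 hjk)
      exact ⟨fun k => k.trans hc, fun k => k.trans hc.symm⟩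

/-- Within a copy, every vertex that is connected to an outer corner is connected to a terminal of
that copy. -/
theorem IsGluing.conn_terminal (hG : IsGluing h V S) {i : Fin 3} {v : α} (hv : v ∈ V i) {o : Fin 6}
    (ho : Conn (Finset.univ.biUnion S) v (h o)) : ∃ j, Conn (S i) v (h (hub i j)) := by
  by_contra! hne
  -- If `v` reaches no terminal of its copy, its component within the copy touches no other copy,
  -- hence is closed in the whole; it would then contain `h o`, which is a terminal.
  have : h o ∈ {w | Conn (S i) v w} := by
    refine ho.mem_of_closed _ ?_ (Conn.refl _ _)
    intro a b hab (hva : Conn (S i) v a)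
    obtain ⟨i', -, hab⟩ := Finset.mem_biUnion.1 hab
    by_cases hi : i' = i
    · exact hva.trans (Conn.of_mem (hi ▸ hab))
    · obtain ⟨k, rfl⟩ := hG.inter i i' (Ne.symm hi) a ((hG.net i).mem_of_conn hva hv)
        ((hG.net i').ends _ hab a (Sym2.mem_mk_left _ _))
      exact absurd hva (hne k)
  obtain ⟨k, hk⟩ := hG.exists_hub ((hG.net i).mem_of_conn this hv)
  exact hne k (hk ▸ this)

/-- Vertex counts add up to three more than that of the whole, edge counts add exactly, and
connections between hubs are given by `glueLab`; Euler's formula is thus exchanged between the whole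
and the parts. -/
theorem IsGluing.isRootedForest_iff (hG : IsGluing h V S) (τ : Pattern) :
    IsRootedForest (Finset.univ.biUnion V) (fun o => h (outer o)) τ (Finset.univ.biUnion S) ↔
      ∃ π : Fin 3 → Pattern,
        (∀ i, IsRootedForest (V i) (fun j => h (hub i j)) (π i) (S i)) ∧ Combines π τ := by
  have hcV := hG.card_biUnion
  have hcS : (Finset.univ.biUnion S).card = (S 0).card + (S 1).card + (S 2).card := by
    rw [Finset.card_biUnion (fun i _ j _ hij => hG.disjoint hij), Fin.sum_univ_three]
  have hmem : ∀ i, ∀ v ∈ V i, v ∈ Finset.univ.biUnion V := fun i v hv =>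
    Finset.mem_biUnion.2 ⟨i, Finset.mem_univ _, hv⟩
  constructor
  · rintro ⟨h1, h2, h3⟩
    have hfull : ∀ i, ∀ v ∈ V i, ∃ j, Conn (S i) v (h (hub i j)) := fun i v hv =>
      let ⟨_, ho⟩ := h1 v (hmem i v hv)
      hG.conn_terminal hv ho
    have hex : ∀ i, ∃ ρ : Pattern,
        ∀ j k, Conn (S i) (h (hub i j)) (h (hub i k)) ↔ ρ.lab j = ρ.lab k := fun i =>
      Pattern.exists_lab ⟨fun _ => Conn.refl _ _, Conn.symm, Conn.trans⟩
    choose π hπ using hex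
    have hhub := hG.conn_hub_iff hπ
    have c1 : ∀ p, ∃ o, glueLab π p = glueLab π (outer o) := by
      intro p
      have : ∃ i j, p = hub i j := by revert p; decide
      obtain ⟨i, j, rfl⟩ := this
      obtain ⟨o, ho⟩ := h1 _ (hmem i _ ((hG.net i).terminal j))
      exact ⟨o, (hhub _ _).1 ho⟩
    have c2 : ∀ i j, glueLab π (outer i) = glueLab π (outer j) ↔ τ.lab i = τ.lab j :=
      fun i j => by rw [← h2, hhub]
    -- The sum of `(V i).card` equals the sum of `(S i).card` plus `3 + τ.size`, so this bound and
    -- the three inequalities `hle` must all be equalities.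
    have c3 := size_le_of_glueLab π τ c1 c2
    have hle : ∀ i, (V i).card ≤ (S i).card + (π i).size := fun i =>
      (hG.net i).card_le (hfull i) (hπ i)
    have l0 := hle 0
    have l1 := hle 1
    have l2 := hle 2
    refine ⟨π, fun i => ⟨hfull i, hπ i, ?_⟩, c1, c2, by omega⟩
    fin_cases i <;> simp only [Fin.zero_eta, Fin.mk_one, Fin.reduceFinMk] <;> omega
  · rintro ⟨π, hf, c1, c2, c3⟩
    have hhub := hG.conn_hub_iff (fun i => (hf i).pattern)
    have l0 := (hf 0).card
    have l1 := (hf 1).card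
    have l2 := (hf 2).card
    refine ⟨fun v hv => ?_, fun i j => by rw [hhub, c2], by omega⟩
    obtain ⟨i, -, hi⟩ := Finset.mem_biUnion.1 hv
    obtain ⟨j, hj⟩ := (hf i).conn v hi
    obtain ⟨o, ho⟩ := c1 (hub i j)
    exact ⟨o, (Conn.biUnion hj).trans ((hhub _ _).2 ho)⟩

/-- The generating functions of a gluing. -/
theorem IsGluing.patternGF_eq {K : Type*} [CommRing K] (hG : IsGluing h V E) (w : Sym2 α → K)
    (τ : Pattern) :
    patternGF (Finset.univ.biUnion V) (fun o => h (outer o)) (Finset.univ.biUnion E) w τ =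
      ∑ π : Fin 3 → Pattern, if Combines π τ then
        ∏ i, patternGF (V i) (fun j => h (hub i j)) (E i) w (π i) else 0 := by
  classical
  have hpart : ∀ S : Fin 3 → Finset (Sym2 α), (∀ i, S i ⊆ E i) → ∀ i,
      Finset.univ.biUnion S ∩ E i = S i := by
    intro S hS i
    ext e
    simp only [Finset.mem_inter, Finset.mem_biUnion, Finset.mem_univ, true_and]
    constructor
    · rintro ⟨⟨j, hj⟩, hi⟩
      by_cases hij : i = j
      · exact hij ▸ hj
      · exact absurd (hS j hj) (Finset.disjoint_left.1 (hG.disjoint hij) hi)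
    · exact fun hi => ⟨⟨i, hi⟩, hS i hi⟩
  have step : patternGF (Finset.univ.biUnion V) (fun o => h (outer o)) (Finset.univ.biUnion E) w τ =
      ∑ S ∈ Fintype.piFinset (fun i => (E i).powerset),
        ∑ π : Fin 3 → Pattern, if Combines π τ then
          ∏ i, if IsRootedForest (V i) (fun j => h (hub i j)) (π i) (S i) then
            ∏ e ∈ S i, w e else 0 else 0 := by
    rw [patternGF, Finset.sum_filter]
    symm
    refine Finset.sum_bij' (fun S _ => Finset.univ.biUnion S) (fun S _ i => S ∩ E i) ?_ ?_ ?_ ?_ ?_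
    · intro S hS
      simp only [Fintype.mem_piFinset, Finset.mem_powerset] at hS ⊢
      exact Finset.biUnion_mono (fun i _ => hS i)
    · intro S _
      simp only [Fintype.mem_piFinset, Finset.mem_powerset]
      exact fun i => Finset.inter_subset_right
    · intro S hS
      simp only [Fintype.mem_piFinset, Finset.mem_powerset] at hS
      exact funext (hpart S hS)
    · intro S hS
      rw [Finset.mem_powerset] at hS
      ext e
      simp only [Finset.mem_biUnion, Finset.mem_univ, true_and, Finset.mem_inter]
      exact ⟨fun ⟨_, he, _⟩ => he, fun he =>
        let ⟨i, _, hi⟩ := Finset.mem_biUnion.1 (hS he)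
        ⟨i, he, hi⟩⟩
    · intro S hS
      simp only [Fintype.mem_piFinset, Finset.mem_powerset] at hS
      have hGS := hG.subset hS
      rw [Finset.prod_biUnion (fun i _ j _ hij => hGS.disjoint hij)]
      by_cases hτ : IsRootedForest (Finset.univ.biUnion V) (fun o => h (outer o)) τ
          (Finset.univ.biUnion S)
      · rw [if_pos hτ]
        obtain ⟨π, hπ, hc⟩ := (hGS.isRootedForest_iff τ).1 hτ
        -- An edge set determines its pattern in each copy, so only one triple contributes.
        rw [Finset.sum_eq_single π, if_pos hc]
        · exact Finset.prod_congr rfl fun i _ => if_pos (hπ i)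
        · intro ρ _ hρ
          split_ifs with hc'
          · obtain ⟨i, hi⟩ := Function.ne_iff.1 hρ
            exact Finset.prod_eq_zero (Finset.mem_univ i)
              (if_neg fun k => hi (k.eq_pattern (hπ i)))
          · rfl
        · simp
      · rw [if_neg hτ]
        refine Finset.sum_eq_zero fun π _ => ?_
        split_ifs with hc
        · by_contra hne
          refine hτ ((hGS.isRootedForest_iff τ).2 ⟨π, fun i => ?_, hc⟩)
          by_contra hi
          exact hne (Finset.prod_eq_zero (Finset.mem_univ i) (if_neg hi))
        · rfl
  rw [step, Finset.sum_comm]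
  refine Finset.sum_congr rfl fun π _ => ?_
  split_ifs with hc
  · rw [← Finset.prod_univ_sum (fun i => (E i).powerset) (fun i s =>
      if IsRootedForest (V i) (fun j => h (hub i j)) (π i) s then ∏ e ∈ s, w e else 0)]
    simp only [patternGF, Finset.sum_filter]
  · exact Finset.sum_const_zero

end Gluing

theorem sum_pattern {M : Type*} [AddCommMonoid M] (f : Pattern → M) :
    ∑ π, f π = f .joined + f .upAlone + f .rightAlone + f .leftAlone + f .discrete := by
  have : (Finset.univ : Finset Pattern) =
      {.joined, .upAlone, .rightAlone, .leftAlone, .discrete} := rfl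
  rw [this]
  simp [Finset.sum_insert, add_assoc]

theorem sum_pattern_triples {M : Type*} [AddCommMonoid M] (f : (Fin 3 → Pattern) → M) :
    ∑ π, f π = ∑ A, ∑ B, ∑ C, f ![A, B, C] := by
  rw [← Fintype.sum_prod_type', ← Fintype.sum_prod_type']
  refine Fintype.sum_equiv ⟨fun π => ((π 0, π 1), π 2), fun x => ![x.1.1, x.1.2, x.2], ?_, ?_⟩ _ _ ?_
  · intro π
    ext i; fin_cases i <;> rfl
  · intro x; rfl
  · intro π
    congr 1
    ext i; fin_cases i <;> rfl

end SpanningGF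

/-! ### Evaluation of the sums over triples of patterns. -/

namespace SpanningGF

theorem sum_combines {K : Type*} [CommRing K] (g : Pattern → K) (τ : Pattern) :
    (∑ π : Fin 3 → Pattern, if Combines π τ then ∏ i, g (π i) else 0) =
      ∑ A, ∑ B, ∑ C, if Combines ![A, B, C] τ then g A * g B * g C else 0 := by
  rw [sum_pattern_triples]
  simp only [Fin.prod_univ_three]
  rfl

/-- Two copies are connected and the third has two blocks; of the nine such triples, the three that
isolate the outer corner of the third copy drop out, whence the factor `2`. -/
theorem sum_combines_joined {K : Type*} [CommRing K] (g : Pattern → K) :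
    (∑ π : Fin 3 → Pattern, if Combines π .joined then ∏ i, g (π i) else 0) =
      2 * g .joined ^ 2 * (g .upAlone + g .rightAlone + g .leftAlone) := by
  rw [sum_combines]
  simp +decide only [sum_pattern, if_true, if_false]
  ring

theorem sum_combines_upAlone {K : Type*} [CommRing K] (g : Pattern → K) :
    (∑ π : Fin 3 → Pattern, if Combines π .upAlone then ∏ i, g (π i) else 0) =
      g .joined * g .upAlone * (2 * g .rightAlone + 2 * g .leftAlone + 3 * g .upAlone) +
        g .joined ^ 2 * g .discrete := by
  rw [sum_combines]
  simp +decide only [sum_pattern, if_true, if_false]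
  ring

theorem sum_combines_rightAlone {K : Type*} [CommRing K] (g : Pattern → K) :
    (∑ π : Fin 3 → Pattern, if Combines π .rightAlone then ∏ i, g (π i) else 0) =
      g .joined * g .rightAlone * (2 * g .leftAlone + 2 * g .upAlone + 3 * g .rightAlone) +
        g .joined ^ 2 * g .discrete := by
  rw [sum_combines]
  simp +decide only [sum_pattern, if_true, if_false]
  ring

theorem sum_combines_leftAlone {K : Type*} [CommRing K] (g : Pattern → K) :
    (∑ π : Fin 3 → Pattern, if Combines π .leftAlone then ∏ i, g (π i) else 0) =
      g .joined * g .leftAlone * (2 * g .rightAlone + 2 * g .upAlone + 3 * g .leftAlone) +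
        g .joined ^ 2 * g .discrete := by
  rw [sum_combines]
  simp +decide only [sum_pattern, if_true, if_false]
  ring

theorem sum_combines_discrete {K : Type*} [CommRing K] (g : Pattern → K) :
    (∑ π : Fin 3 → Pattern, if Combines π .discrete then ∏ i, g (π i) else 0) =
      4 * g .joined * g .discrete * (g .upAlone + g .rightAlone + g .leftAlone) +
        2 * (g .upAlone ^ 2 * (g .rightAlone + g .leftAlone) +
          g .rightAlone ^ 2 * (g .leftAlone + g .upAlone) +
          g .leftAlone ^ 2 * (g .rightAlone + g .upAlone)) +
        2 * g .upAlone * g .rightAlone * g .leftAlone := by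
  rw [sum_combines]
  simp +decide only [sum_pattern, if_true, if_false]
  ring

/-! ### Invariance under injective maps of the vertices. -/

section Translate

variable {α β : Type*} [DecidableEq β] {f : α → β} {V : Finset α} {t : Fin 3 → α}
  {E S : Finset (Sym2 α)}

theorem conn_image_iff (hf : Function.Injective f) (p q : α) :
    Conn (S.image (Sym2.map f)) (f p) (f q) ↔ Conn S p q := by
  constructor
  · intro h
    have : f q ∈ {y | ∃ x, y = f x ∧ Conn S p x} := by
      refine h.mem_of_closed _ ?_ ⟨p, rfl, Conn.refl _ _⟩
      rintro _ b hab ⟨x, rfl, hx⟩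
      obtain ⟨e, he, hab⟩ := Finset.mem_image.1 hab
      have hxe : f x ∈ e.map f := hab ▸ Sym2.mem_mk_left _ _
      obtain ⟨x', hx', hxx⟩ := Sym2.mem_map.1 hxe
      obtain rfl := hf hxx
      obtain ⟨y, rfl⟩ := hx'
      rw [Sym2.map_mk, Sym2.congr_right] at hab
      exact ⟨y, hab.symm, hx.trans (Conn.of_mem he)⟩
    obtain ⟨x, hx, hpx⟩ := this
    exact hf hx ▸ hpx
  · intro h
    refine h.mem_of_closed {x | Conn (S.image (Sym2.map f)) (f p) (f x)} ?_ (Conn.refl _ _)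
    intro a b hab ha
    exact Conn.trans ha (Conn.of_mem (Finset.mem_image.2 ⟨_, hab, rfl⟩))

theorem IsNetwork.image (h : IsNetwork V t E) (hf : Function.Injective f) :
    IsNetwork (V.image f) (fun i => f (t i)) (E.image (Sym2.map f)) := by
  refine ⟨fun i => Finset.mem_image_of_mem f (h.terminal i), fun e he p hp => ?_, fun e he => ?_⟩
  · obtain ⟨e', he', rfl⟩ := Finset.mem_image.1 he
    obtain ⟨q, hq, rfl⟩ := Sym2.mem_map.1 hp
    exact Finset.mem_image_of_mem f (h.ends e' he' q hq)
  · obtain ⟨e', he', rfl⟩ := Finset.mem_image.1 he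
    rw [Sym2.isDiag_map hf]
    exact h.loopless e' he'

theorem isRootedForest_image_iff (hf : Function.Injective f) (π : Pattern) :
    IsRootedForest (V.image f) (fun i => f (t i)) π (S.image (Sym2.map f)) ↔
      IsRootedForest V t π S := by
  have hS : (S.image (Sym2.map f)).card = S.card :=
    Finset.card_image_of_injective _ (Sym2.map.injective hf)
  have hV : (V.image f).card = V.card := Finset.card_image_of_injective _ hf
  constructor
  · rintro ⟨h1, h2, h3⟩
    refine ⟨fun v hv => ?_, fun i j => by rw [← h2, conn_image_iff hf], by rw [← hS, ← hV, h3]⟩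
    obtain ⟨i, hi⟩ := h1 (f v) (Finset.mem_image_of_mem f hv)
    exact ⟨i, (conn_image_iff hf _ _).1 hi⟩
  · rintro ⟨h1, h2, h3⟩
    refine ⟨fun v hv => ?_, fun i j => by rw [← h2, conn_image_iff hf], by rw [hS, hV, h3]⟩
    obtain ⟨u, hu, rfl⟩ := Finset.mem_image.1 hv
    obtain ⟨i, hi⟩ := h1 u hu
    exact ⟨i, (conn_image_iff hf _ _).2 hi⟩

theorem patternGF_image {K : Type*} [CommRing K] (hf : Function.Injective f) (w : Sym2 β → K)
    (π : Pattern) :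
    patternGF (V.image f) (fun i => f (t i)) (E.image (Sym2.map f)) w π =
      patternGF V t E (fun e => w (e.map f)) π := by
  classical
  have hinj : Function.Injective (Sym2.map f) := Sym2.map.injective hf
  have hp : (E.image (Sym2.map f)).powerset = E.powerset.image (Finset.image (Sym2.map f)) := by
    ext S
    rw [Finset.mem_powerset, Finset.subset_image_iff]
    simp only [Finset.mem_image, Finset.mem_powerset]
  rw [patternGF, patternGF, Finset.sum_filter, Finset.sum_filter, hp,
    Finset.sum_image (fun S _ S' _ h => Finset.image_injective hinj h)]
  refine Finset.sum_congr rfl fun S _ => ?_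
  simp only [isRootedForest_image_iff hf]
  rw [Finset.prod_image (fun e _ e' _ h => hinj h)]

end Translate

end SpanningGF

/-! ### Sierpiński graphs as gluings of translates. -/

namespace Sierpinski

open SpanningGF

/-- The three corners. -/
def corners (k : ℕ) : Fin 3 → ℕ × ℕ := ![(0, 0), (2 ^ k, 0), (0, 2 ^ k)]

/-- The outer corners of the graph of side `2 ^ (k + 1)` and the midpoints of its sides. -/
def hubs (k : ℕ) : Fin 6 → ℕ × ℕ :=
  ![(0, 0), (2 ^ (k + 1), 0), (0, 2 ^ (k + 1)), (2 ^ k, 0), (0, 2 ^ k), (2 ^ k, 2 ^ k)]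

theorem isNetwork (k : ℕ) : IsNetwork (vertices k) (corners k) (edges k) := by
  refine ⟨fun i => ?_, mem_vertices_of_mem_edges k, ?_⟩
  · fin_cases i
    · exact left_mem k
    · exact right_mem k
    · exact up_mem k
  · induction k with
    | zero => decide
    | succ k ih =>
      intro e he
      simp only [edges, Finset.mem_union, Finset.mem_image] at he
      rcases he with (he | ⟨f, hf, rfl⟩) | ⟨f, hf, rfl⟩
      · exact ih e he
      · rw [Sym2.isDiag_map (add_left_injective _)]
        exact ih f hf
      · rw [Sym2.isDiag_map (add_left_injective _)]
        exact ih f hf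

/-- Confines each copy to its own triangle, so that different translates can meet only in the shared
midpoint. -/
theorem vertices_le (k : ℕ) : ∀ p ∈ vertices k, p.1 + p.2 ≤ 2 ^ k := by
  induction k with
  | zero => decide
  | succ k ih =>
    intro p hp
    simp only [vertices, Finset.mem_union, Finset.mem_image] at hp
    have h2 : 2 ^ (k + 1) = 2 ^ k + 2 ^ k := by ring
    rcases hp with (hp | ⟨q, hq, rfl⟩) | ⟨q, hq, rfl⟩
    · have := ih p hp
      omega
    · have := ih q hq
      simp only [Prod.fst_add, Prod.snd_add]
      omega
    · have := ih q hq
      simp only [Prod.fst_add, Prod.snd_add]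
      omega

theorem hubs_hub (k : ℕ) (i j : Fin 3) :
    hubs k (hub i j) = corners k j + corners k i := by
  have h2 : 2 ^ (k + 1) = 2 ^ k + 2 ^ k := by ring
  fin_cases i <;> fin_cases j <;> simp [hubs, hub, corners, h2]

theorem isGluing (k : ℕ) :
    IsGluing (hubs k) (fun i => (vertices k).image (· + corners k i))
      (fun i => (edges k).image (Sym2.map (· + corners k i))) := by
  have h0 : 0 < 2 ^ k := by positivity
  have h2 : 2 ^ (k + 1) = 2 ^ k + 2 ^ k := by ring
  refine ⟨?_, fun i => ?_, fun i j hij v hi hj => ?_⟩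
  · intro p q hpq
    fin_cases p <;> fin_cases q <;> simp [hubs, h2, Prod.ext_iff] at hpq ⊢ <;> omega
  · simp only [hubs_hub]
    exact (isNetwork k).image (add_left_injective _)
  · obtain ⟨p, hp, rfl⟩ := Finset.mem_image.1 hi
    obtain ⟨q, hq, hqp⟩ := Finset.mem_image.1 hj
    have hp' := vertices_le k p hp
    have hq' := vertices_le k q hq
    -- Copies `i` and `j` meet only at `corners k i + corners k j`, which is terminal `j` of copy
    -- `i`.
    refine ⟨j, ?_⟩
    rw [hubs_hub]
    obtain ⟨p1, p2⟩ := p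
    obtain ⟨q1, q2⟩ := q
    simp only [Prod.ext_iff, Prod.fst_add, Prod.snd_add] at hqp hp' hq' ⊢
    fin_cases i <;> fin_cases j <;> simp [corners] at hij hqp ⊢ <;> omega

theorem biUnion_vertices (k : ℕ) :
    Finset.univ.biUnion (fun i => (vertices k).image (· + corners k i)) = vertices (k + 1) := by
  have h : ∀ p : ℕ × ℕ, p + (0, 0) = p := fun _ => rfl
  ext p
  simp [Fin.exists_fin_succ, vertices, corners, h, -Prod.exists]

theorem biUnion_edges (k : ℕ) :
    Finset.univ.biUnion (fun i => (edges k).image (Sym2.map (· + corners k i))) =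
      edges (k + 1) := by
  have h : (fun p : ℕ × ℕ => p + (0, 0)) = id := rfl
  ext p
  simp [Fin.exists_fin_succ, edges, corners, h]

theorem outer_corners (k : ℕ) : (fun o => hubs k (outer o)) = corners (k + 1) := by
  funext o
  fin_cases o <;> rfl

theorem label_map_add {K : Type*} (a b c : K) (d : ℕ × ℕ) (e : Sym2 (ℕ × ℕ)) :
    label a b c (e.map (· + d)) = label a b c e := by
  induction e using Sym2.ind with | _ p q
  simp [label]

/-- The generating functions of the Sierpiński graph of side `2 ^ k`. -/
noncomputable def cornerGF {K : Type*} [CommRing K] (a b c : K) (k : ℕ) (π : Pattern) : K :=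
  patternGF (vertices k) (corners k) (edges k) (label a b c) π

theorem cornerGF_succ {K : Type*} [CommRing K] (a b c : K) (k : ℕ) (τ : Pattern) :
    cornerGF a b c (k + 1) τ =
      ∑ π : Fin 3 → Pattern, if Combines π τ then ∏ i, cornerGF a b c k (π i) else 0 := by
  have h := (isGluing k).patternGF_eq (label a b c) τ
  rw [biUnion_vertices, biUnion_edges, outer_corners] at h
  simp only [hubs_hub] at h
  simp only [cornerGF, h]
  refine Finset.sum_congr rfl fun π _ => if_congr Iff.rfl (Finset.prod_congr rfl fun i _ => ?_) rfl
  rw [patternGF_image (f := (· + corners k i)) (add_left_injective _)]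
  simp only [label_map_add]

/-! ### The triangle. -/

section Initial

/-- The corners `i` and `j` of the triangle are not separated by a set closed under adjacency. -/
def TriangleConn (S : Finset (Sym2 (ℕ × ℕ))) (i j : Fin 3) : Prop :=
  ∀ X : Finset (Fin 3), (∀ p q, s(corners 0 p, corners 0 q) ∈ S → p ∈ X → q ∈ X) → i ∈ X → j ∈ X

instance (S : Finset (Sym2 (ℕ × ℕ))) (i j : Fin 3) : Decidable (TriangleConn S i j) := by
  unfold TriangleConn; infer_instance

/-- Replaces paths by a condition on subsets of `Fin 3`, so that connectivity in the triangle
becomes decidable. -/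
theorem conn_triangle_iff {S : Finset (Sym2 (ℕ × ℕ))} (hS : S ⊆ edges 0) (i j : Fin 3) :
    Conn S (corners 0 i) (corners 0 j) ↔
      TriangleConn S i j := by
  have hinj : Function.Injective (corners 0) := by decide
  have hV : ∀ v ∈ vertices 0, ∃ p, v = corners 0 p := by decide
  constructor
  · intro h X hX hi
    have : corners 0 j ∈ {v | ∃ p ∈ X, v = corners 0 p} := by
      refine h.mem_of_closed _ ?_ ⟨i, hi, rfl⟩
      rintro _ b hab ⟨p, hp, rfl⟩
      obtain ⟨q, rfl⟩ := hV b (((isNetwork 0).subset hS).ends _ hab _ (Sym2.mem_mk_right _ _))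
      exact ⟨q, hX p q hab hp, rfl⟩
    obtain ⟨p, hp, hjp⟩ := this
    exact hinj hjp ▸ hp
  · intro h
    classical
    have := h (Finset.univ.filter fun q => Conn S (corners 0 i) (corners 0 q)) (fun p q hpq hp => by
      simp only [Finset.mem_filter, Finset.mem_univ, true_and] at hp ⊢
      exact hp.trans (Conn.of_mem hpq)) (by simp [Conn.refl])
    simpa using this

/-- The rooted forests of the triangle. -/
def triangleForests : Pattern → Finset (Finset (Sym2 (ℕ × ℕ)))
  | .joined => {{s((0, 0), (1, 0)), s((0, 0), (0, 1))}, {s((0, 0), (0, 1)), s((0, 1), (1, 0))},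
      {s((0, 0), (1, 0)), s((0, 1), (1, 0))}}
  | .upAlone => {{s((0, 0), (1, 0))}}
  | .rightAlone => {{s((0, 0), (0, 1))}}
  | .leftAlone => {{s((0, 1), (1, 0))}}
  | .discrete => {∅}

theorem isRootedForest_triangle_iff (π : Pattern) {S : Finset (Sym2 (ℕ × ℕ))} (hS : S ⊆ edges 0) :
    IsRootedForest (vertices 0) (corners 0) π S ↔ S ∈ triangleForests π := by
  have hV : ∀ v ∈ vertices 0, ∃ p, v = corners 0 p := by decide
  have h1 : IsRootedForest (vertices 0) (corners 0) π S ↔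
      (∀ i j, TriangleConn S i j ↔ π.lab i = π.lab j) ∧ S.card + π.size = 3 := by
    constructor
    · rintro ⟨-, h2, h3⟩
      exact ⟨fun i j => by rw [← h2, conn_triangle_iff hS], h3⟩
    · rintro ⟨h2, h3⟩
      refine ⟨fun v hv => ?_, fun i j => by rw [← h2, conn_triangle_iff hS], h3⟩
      obtain ⟨p, rfl⟩ := hV v hv
      exact ⟨p, Conn.refl _ _⟩
  rw [h1]
  have key : ∀ π : Pattern, ∀ S ∈ (edges 0).powerset,
      (∀ i j, TriangleConn S i j ↔ π.lab i = π.lab j) ∧ S.card + π.size = 3 ↔ S ∈ triangleForests π := by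
    decide +kernel
  exact key π S (Finset.mem_powerset.2 hS)

theorem cornerGF_zero {K : Type*} [CommRing K] (a b c : K) (π : Pattern) :
    cornerGF a b c 0 π = ∑ S ∈ triangleForests π, ∏ e ∈ S, label a b c e := by
  classical
  rw [cornerGF, patternGF]
  refine Finset.sum_congr ?_ fun _ _ => rfl
  ext S
  rw [Finset.mem_filter, Finset.mem_powerset]
  constructor
  · exact fun h => (isRootedForest_triangle_iff π h.1).1 h.2
  · intro h
    have hS : S ⊆ edges 0 := by
      revert S; cases π <;> decide
    exact ⟨hS, (isRootedForest_triangle_iff π hS).2 h⟩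

theorem cornerGF_zero_joined {K : Type*} [CommRing K] (a b c : K) :
    cornerGF a b c 0 .joined = a * b + a * c + b * c := by
  rw [cornerGF_zero, triangleForests, Finset.sum_insert (by decide), Finset.sum_insert (by decide),
    Finset.sum_singleton, Finset.prod_pair (by decide), Finset.prod_pair (by decide),
    Finset.prod_pair (by decide)]
  simp [label]
  ring

end Initial

/-! ### The five generating functions as pattern generating functions. -/

section Link

variable {S : Finset (Sym2 (ℕ × ℕ))} {k : ℕ}

theorem isRootedForest_iff (hS : S ⊆ edges k) (π : Pattern) (Pt : Prop)
    (hPt : Pt ↔ ∀ i j, Conn S (corners k i) (corners k j) ↔ π.lab i = π.lab j) :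
    (IsSpanningForest (gasket k) π.size (graphOn (vertices k) S) ∧ Pt) ↔
      IsRootedForest (vertices k) (corners k) π S := by
  have hle : graphOn (vertices k) S ≤ gasket k := fun p q hpq =>
    SimpleGraph.fromEdgeSet_mono (Finset.coe_subset.2 hS) hpq
  rw [((isNetwork k).subset hS).isRootedForest_iff, IsSpanningForest, hPt]
  simp only [hle, true_and, and_assoc]

theorem reachable_iff (hS : S ⊆ edges k) :
    ((graphOn (vertices k) S).Reachable (left k) (right k) ↔
      Conn S (corners k 0) (corners k 1)) ∧
    ((graphOn (vertices k) S).Reachable (left k) (up k) ↔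
      Conn S (corners k 0) (corners k 2)) ∧
    ((graphOn (vertices k) S).Reachable (right k) (up k) ↔
      Conn S (corners k 1) (corners k 2)) ∧
    ((graphOn (vertices k) S).Reachable (right k) (left k) ↔
      Conn S (corners k 1) (corners k 0)) :=
  have h := ((isNetwork k).subset hS).reachable_iff
  ⟨h _ _, h _ _, h _ _, h _ _⟩

theorem genFun_eq_cornerGF {K : Type*} [CommRing K] (a b c : K) (π : Pattern)
    (Pt : SimpleGraph (vertices k) → Prop)
    (hPt : ∀ S ⊆ edges k, Pt (graphOn (vertices k) S) ↔
      ∀ i j, Conn S (corners k i) (corners k j) ↔ π.lab i = π.lab j) :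
    genFun (dirLabel a b c k) (fun H => IsSpanningForest (gasket k) π.size H ∧ Pt H) =
      cornerGF a b c k π :=
  genFun_eq_patternGF (isNetwork k) (label a b c) π _
    (fun S hS => isRootedForest_iff hS π _ (hPt S hS)) (fun _ hH => hH.1.1)

variable {K : Type*} [CommRing K] (a b c : K) (n : ℕ)

/-- `Preconnected` repeats what having one component says; it supplies the side condition `Pt` of
`isRootedForest_iff`. -/
theorem isSpanningTree_iff {H : SimpleGraph (vertices k)} :
    IsSpanningTree (gasket k) H ↔ IsSpanningForest (gasket k) 1 H ∧ H.Preconnected := by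
  have hne : Nonempty (vertices k) := ⟨left k⟩
  constructor
  · rintro ⟨h1, h2⟩
    have h3 := h2.connected.preconnected
    have : Subsingleton H.ConnectedComponent := h3.subsingleton_connectedComponent
    exact ⟨⟨h1, h2.isAcyclic, Nat.card_eq_one_iff_unique.2
      ⟨this, ⟨H.connectedComponentMk (left k)⟩⟩⟩, h3⟩
  · rintro ⟨⟨h1, h2, -⟩, h3⟩
    exact ⟨h1, ⟨h3⟩, h2⟩

theorem T_eq : T a b c n = cornerGF a b c (n - 1) .joined := by
  refine genFun_eq_patternGF (isNetwork (n - 1)) (label a b c) .joined _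
    (fun S hS => ?_) (fun _ hH => hH.1)
  have hne : Nonempty (vertices (n - 1)) := ⟨left (n - 1)⟩
  have hN := (isNetwork (n - 1)).subset hS
  rw [isSpanningTree_iff, ← isRootedForest_iff hS .joined _ Iff.rfl]
  refine and_congr_right fun hF => ⟨fun h i j => ?_, fun _ => ?_⟩
  · rw [← hN.reachable_iff ⟨_, hN.terminal i⟩ ⟨_, hN.terminal j⟩]
    exact iff_of_true (h _ _) (by revert i j; decide)
  · have := (Nat.card_eq_one_iff_unique.1 hF.2.2).1
    exact fun p q => SimpleGraph.ConnectedComponent.exact (Subsingleton.elim _ _)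

/-- By symmetry and reflexivity three pairs suffice; in `U_eq`, `R_eq` and `L_eq` transitivity
settles the pair that the definition omits. -/
theorem pattern_conn_iff (S : Finset (Sym2 (ℕ × ℕ))) (t : Fin 3 → ℕ × ℕ) (π : Pattern) :
    (∀ i j, Conn S (t i) (t j) ↔ π.lab i = π.lab j) ↔
      (Conn S (t 0) (t 1) ↔ π.lab 0 = π.lab 1) ∧ (Conn S (t 0) (t 2) ↔ π.lab 0 = π.lab 2) ∧
      (Conn S (t 1) (t 2) ↔ π.lab 1 = π.lab 2) := by
  have hs : ∀ i j, Conn S (t i) (t j) ↔ Conn S (t j) (t i) := fun i j => ⟨Conn.symm, Conn.symm⟩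
  simp only [Fin.forall_fin_succ, Fin.succ_zero_eq_one, Fin.succ_one_eq_two, IsEmpty.forall_iff,
    Conn.refl, hs 1 0, hs 2 0, hs 2 1, eq_comm (a := π.lab 2), eq_comm (a := π.lab 1) (b := π.lab 0)]
  tauto

theorem U_eq : U a b c n = cornerGF a b c (n - 1) .upAlone := by
  refine genFun_eq_cornerGF a b c .upAlone _ fun S hS => ?_
  obtain ⟨h1, h2, h3, h4⟩ := reachable_iff hS
  rw [h1, h2, pattern_conn_iff]
  simp +decide only [iff_true, iff_false]
  exact ⟨fun ⟨h, k⟩ => ⟨h, k, fun l => k (h.trans l)⟩, fun ⟨h, k, _⟩ => ⟨h, k⟩⟩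

theorem R_eq : R a b c n = cornerGF a b c (n - 1) .rightAlone := by
  refine genFun_eq_cornerGF a b c .rightAlone _ fun S hS => ?_
  obtain ⟨h1, h2, h3, h4⟩ := reachable_iff hS
  rw [h1, h2, pattern_conn_iff]
  simp +decide only [iff_true, iff_false]
  exact ⟨fun ⟨h, k⟩ => ⟨k, h, fun l => k (h.trans l.symm)⟩, fun ⟨h, k, _⟩ => ⟨k, h⟩⟩

theorem L_eq : L a b c n = cornerGF a b c (n - 1) .leftAlone := by
  refine genFun_eq_cornerGF a b c .leftAlone _ fun S hS => ?_
  obtain ⟨h1, h2, h3, h4⟩ := reachable_iff hS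
  rw [h3, h4, pattern_conn_iff]
  simp +decide only [iff_true, iff_false]
  exact ⟨fun ⟨h, k⟩ => ⟨fun l => k l.symm, fun l => k (h.trans l.symm), h⟩,
    fun ⟨h, _, k⟩ => ⟨k, fun l => h l.symm⟩⟩

theorem Q_eq : Q a b c n = cornerGF a b c (n - 1) .discrete := by
  refine genFun_eq_cornerGF a b c .discrete _ fun S hS => ?_
  obtain ⟨h1, h2, h3, h4⟩ := reachable_iff hS
  rw [h1, h2, h3, pattern_conn_iff]
  simp +decide only [iff_false]

end Link

end Sierpinski

theorem mainTheorem10 {K : Type*} [CommRing K] (a b c : K) :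
    (∀ n : ℕ, 1 ≤ n →
      Sierpinski.T a b c (n + 1)
          = 2 * Sierpinski.T a b c n ^ 2
            * (Sierpinski.U a b c n + Sierpinski.R a b c n + Sierpinski.L a b c n) ∧
      Sierpinski.U a b c (n + 1)
          = Sierpinski.T a b c n * Sierpinski.U a b c n
            * (2 * Sierpinski.R a b c n + 2 * Sierpinski.L a b c n + 3 * Sierpinski.U a b c n)
            + Sierpinski.T a b c n ^ 2 * Sierpinski.Q a b c n ∧
      Sierpinski.R a b c (n + 1)
          = Sierpinski.T a b c n * Sierpinski.R a b c n
            * (2 * Sierpinski.L a b c n + 2 * Sierpinski.U a b c n + 3 * Sierpinski.R a b c n)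
            + Sierpinski.T a b c n ^ 2 * Sierpinski.Q a b c n ∧
      Sierpinski.L a b c (n + 1)
          = Sierpinski.T a b c n * Sierpinski.L a b c n
            * (2 * Sierpinski.R a b c n + 2 * Sierpinski.U a b c n + 3 * Sierpinski.L a b c n)
            + Sierpinski.T a b c n ^ 2 * Sierpinski.Q a b c n ∧
      Sierpinski.Q a b c (n + 1)
          = 4 * Sierpinski.T a b c n * Sierpinski.Q a b c n
            * (Sierpinski.U a b c n + Sierpinski.R a b c n + Sierpinski.L a b c n)
            + 2 * (Sierpinski.U a b c n ^ 2 * (Sierpinski.R a b c n + Sierpinski.L a b c n)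
              + Sierpinski.R a b c n ^ 2 * (Sierpinski.L a b c n + Sierpinski.U a b c n)
              + Sierpinski.L a b c n ^ 2 * (Sierpinski.R a b c n + Sierpinski.U a b c n))
            + 2 * Sierpinski.U a b c n * Sierpinski.R a b c n * Sierpinski.L a b c n) ∧
    Sierpinski.T a b c 1 = a * b + a * c + b * c ∧
    Sierpinski.U a b c 1 = b ∧
    Sierpinski.R a b c 1 = a ∧
    Sierpinski.L a b c 1 = c ∧
    Sierpinski.Q a b c 1 = 1 := by

  simp only [Sierpinski.T_eq, Sierpinski.U_eq, Sierpinski.R_eq, Sierpinski.L_eq, Sierpinski.Q_eq,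
    Nat.sub_self, Nat.add_sub_cancel]
  refine ⟨fun n hn => ?_, Sierpinski.cornerGF_zero_joined a b c, ?_, ?_, ?_, ?_⟩
  -- Writing `n = k + 1` removes the truncated subtraction: the recursion goes from side `2 ^ k` to
  -- side `2 ^ (k + 1)`.
  · obtain ⟨k, rfl⟩ := Nat.exists_eq_add_of_le' hn
    simp only [Nat.add_sub_cancel, Sierpinski.cornerGF_succ]
    exact ⟨SpanningGF.sum_combines_joined _, SpanningGF.sum_combines_upAlone _,
      SpanningGF.sum_combines_rightAlone _, SpanningGF.sum_combines_leftAlone _,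
      SpanningGF.sum_combines_discrete _⟩
  all_goals
    rw [Sierpinski.cornerGF_zero]
    simp [Sierpinski.triangleForests, Sierpinski.label]
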